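/- Let $\mathcal T$ be the Toeplitz algebra, i.e. the universal unital $C^*$-algebra generated by one isometry $s$, let $u$ be the generating unitary of $C(S^1)$ (the inclusion $S^1\hookrightarrow\mathbb C$), and let $\sigma\colon\mathcal T\to C(S^1)$, $\sigma(s)=u$, be the symbol map. Let $\otimes$ denote the minimal tensor product of $C^*$-algebras. Let $C(S^5_H)$ be the triple-pullback $C^*$-algebra of all $$(b_0,b_1,b_2)\in \big(C(S^1)\otimes\mathcal T\otimes\mathcal T\big)\times\big(\mathcal T\otimes C(S^1)\otimes\mathcal T\big)\times\big(\mathcal T\otimes\mathcal T\otimes C(S^1)\big)$$ such that $$(\mathrm{id}\otimes\sigma\otimes\mathrm{id})(b_0)=(\sigma\otimes\mathrm{id}\otimes\mathrm{id})(b_1),\quad (\mathrm{id}\otimes\mathrm{id}\otimes\sigma)(b_0)=(\sigma\otimes\mathrm{id}\otimes\mathrm{id})(b_2),\quad (\mathrm{id}\otimes\mathrm{id}\otimes\sigma)(b_1)=(\mathrm{id}\otimes\sigma\otimes\mathrm{id})(b_2).$$ Let $g\in U(1)$ act on $\mathcal T$ by the gauge automorphism $s\mapsto gs$, on $C(S^1)$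 by the automorphism $u\mapsto gu$, on each of the triple tensor products by the tensor product of these automorphisms, and on $C(S^5_H)$ by the restriction $\alpha_g$ of the componentwise action. This is the diagonal $U(1)$-action on $C(S^5_H)$. **Theorem 2.2.** The diagonal $U(1)$-action $\alpha$ on $A:=C(S^5_H)$ is free in the sense of Ellwood: with $\delta\colon A\to C(U(1),A)\cong A\otimes C(U(1))$, $\delta(a)(g):=\alpha_g(a)$, the closed linear span of $\{(x\otimes 1)\,\delta(y)\mid x,y\in A\}$ is all of $A\otimes C(U(1))$. -/

import Mathlib

open scoped TensorProduct ComplexConjugate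

noncomputable section

/-! ### C*-seminorms and the C*-algebras they generate -/

/-- A C*-seminorm on a unital complex *-algebra: a submultiplicative seminorm with
`p x ^ 2 ≤ p (x* x)`.  (Together with submultiplicativity this gives `p x* = p x` and the
C*-identity `p (x* x) = p x ^ 2`.) -/
structure CStarSeminorm (A : Type*) [Ring A] [Algebra ℂ A] [StarRing A] extends
    Seminorm ℂ A where
  mul_le' : ∀ x y : A, toFun (x * y) ≤ toFun x * toFun y
  mul_self_le' : ∀ x : A, toFun x * toFun x ≤ toFun (star x * x)

namespace CStarSeminorm

section Basic

variable {A : Type*} [Ring A] [Algebra ℂ A] [StarRing A] (p : CStarSeminorm A)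

instance : CoeFun (CStarSeminorm A) (fun _ => A → ℝ) := ⟨fun p => p.toSeminorm⟩

theorem nonneg (x : A) : 0 ≤ p x := apply_nonneg p.toSeminorm x

theorem mul_le (x y : A) : p (x * y) ≤ p x * p y := p.mul_le' x y

theorem mul_self_le (x : A) : p x * p x ≤ p (star x * x) := p.mul_self_le' x

theorem le_star (x : A) : p x ≤ p (star x) := by
  rcases (p.nonneg x).eq_or_lt with h | h
  · rw [← h]; exact p.nonneg _
  · exact le_of_mul_le_mul_right ((p.mul_self_le x).trans (p.mul_le _ _)) h

theorem star_eq (x : A) : p (star x) = p x :=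
  le_antisymm (by simpa using p.le_star (star x)) (p.le_star x)

/-- The pointwise supremum of a pointwise bounded family of C*-seminorms. -/
def iSup {ι : Type*} (q : ι → CStarSeminorm A)
    (hq : ∀ x, BddAbove (Set.range fun i => q i x)) : CStarSeminorm A where
  toFun x := ⨆ i, q i x
  map_zero' := by simp
  add_le' x y := Real.iSup_le (fun i => (map_add_le_add (q i).toSeminorm x y).trans
      (add_le_add (le_ciSup (hq x) i) (le_ciSup (hq y) i)))
    (add_nonneg (Real.iSup_nonneg fun i => (q i).nonneg x)
      (Real.iSup_nonneg fun i => (q i).nonneg y))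
  neg' x := by simp
  smul' c x := by
    simp only [map_smul_eq_mul]
    rw [Real.mul_iSup_of_nonneg (norm_nonneg c)]
  mul_le' x y := Real.iSup_le (fun i => ((q i).mul_le x y).trans
      (mul_le_mul (le_ciSup (hq x) i) (le_ciSup (hq y) i) ((q i).nonneg y)
        (Real.iSup_nonneg fun i => (q i).nonneg x)))
    (mul_nonneg (Real.iSup_nonneg fun i => (q i).nonneg x)
      (Real.iSup_nonneg fun i => (q i).nonneg y))
  mul_self_le' x := by
    have h0 : 0 ≤ ⨆ i, q i (star x * x) := Real.iSup_nonneg fun i => (q i).nonneg _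
    have h : (⨆ i, q i x) ≤ Real.sqrt (⨆ i, q i (star x * x)) :=
      Real.iSup_le (fun i => Real.le_sqrt_of_sq_le (by
        rw [sq]
        exact ((q i).mul_self_le x).trans (le_ciSup (hq (star x * x)) i))) (Real.sqrt_nonneg _)
    calc _ ≤ Real.sqrt (⨆ i, q i (star x * x)) * Real.sqrt (⨆ i, q i (star x * x)) :=
          mul_self_le_mul_self (Real.iSup_nonneg fun i => (q i).nonneg x) h
      _ = _ := Real.mul_self_sqrt h0

theorem le_iSup {ι : Type*} (q : ι → CStarSeminorm A)
    (hq : ∀ x, BddAbove (Set.range fun i => q i x)) (i : ι) (x : A) : q i x ≤ iSup q hq x :=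
  le_ciSup (hq x) i

theorem iSup_le {ι : Type*} (q : ι → CStarSeminorm A)
    (hq : ∀ x, BddAbove (Set.range fun i => q i x)) {x : A} {c : ℝ} (hc : 0 ≤ c)
    (h : ∀ i, q i x ≤ c) : iSup q hq x ≤ c :=
  Real.iSup_le h hc

/-- The C*-seminorm `x ↦ ‖f x‖` induced by a *-homomorphism `f` into a C*-algebra. -/
def ofHom {B : Type*} [CStarAlgebra B] (f : A →⋆ₐ[ℂ] B) : CStarSeminorm A where
  toFun x := ‖f x‖
  map_zero' := by simp
  add_le' x y := by rw [map_add]; exact norm_add_le _ _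
  neg' x := by simp
  smul' c x := by rw [map_smul, norm_smul]
  mul_le' x y := by rw [map_mul]; exact norm_mul_le _ _
  mul_self_le' x := by rw [map_mul, map_star, CStarRing.norm_star_mul_self]

@[simp] theorem ofHom_apply {B : Type*} [CStarAlgebra B] (f : A →⋆ₐ[ℂ] B) (x : A) :
    ofHom f x = ‖f x‖ := rfl

end Basic

section Completion

variable {A : Type*} [Ring A] [Algebra ℂ A] [StarRing A] (p : CStarSeminorm A)

/-- The *-algebra `A` regarded as a seminormed algebra by means of the C*-seminorm `p`. -/
def Carrier (_ : CStarSeminorm A) : Type _ := A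

instance : Ring p.Carrier := inferInstanceAs (Ring A)
instance : Algebra ℂ p.Carrier := inferInstanceAs (Algebra ℂ A)
instance : StarRing p.Carrier := inferInstanceAs (StarRing A)

instance : SeminormedRing p.Carrier where
  toRing := inferInstance
  toPseudoMetricSpace := (p.toAddGroupSeminorm.toSeminormedAddCommGroup).toPseudoMetricSpace
  norm := p.toFun
  dist_eq := (p.toAddGroupSeminorm.toSeminormedAddCommGroup).dist_eq
  norm_mul_le := p.mul_le'

theorem norm_carrier (x : p.Carrier) : ‖x‖ = p (show A from x) := rfl

instance : NormedAlgebra ℂ p.Carrier where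
  toAlgebra := inferInstance
  norm_smul_le c x := (p.smul' c x).le

/-- The C*-algebra obtained from `A` and a C*-seminorm `p`: the Hausdorff completion of `A`. -/
def Completion : Type _ := UniformSpace.Completion p.Carrier

namespace Completion

instance : NormedRing p.Completion :=
  inferInstanceAs (NormedRing (UniformSpace.Completion p.Carrier))
instance : CompleteSpace p.Completion :=
  inferInstanceAs (CompleteSpace (UniformSpace.Completion p.Carrier))
instance : NormedAlgebra ℂ p.Completion where
  toAlgebra := inferInstanceAs (Algebra ℂ (UniformSpace.Completion p.Carrier))
  norm_smul_le c x := norm_smul_le c (show UniformSpace.Completion p.Carrier from x)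

/-- The canonical map into the completion, as a plain function. -/
def mk (x : A) : p.Completion :=
  ((show p.Carrier from x : p.Carrier) : UniformSpace.Completion p.Carrier)

theorem denseRange_mk : DenseRange (mk p) :=
  UniformSpace.Completion.denseRange_coe (α := p.Carrier)

theorem norm_mk (x : A) : ‖mk p x‖ = p x :=
  UniformSpace.Completion.norm_coe (E := p.Carrier) x

theorem mk_add (x y : A) : mk p (x + y) = mk p x + mk p y :=
  UniformSpace.Completion.coe_add (α := p.Carrier) x y
theorem mk_sub (x y : A) : mk p (x - y) = mk p x - mk p y :=
  UniformSpace.Completion.coe_sub (α := p.Carrier) x y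
theorem mk_mul (x y : A) : mk p (x * y) = mk p x * mk p y :=
  UniformSpace.Completion.coe_mul (α := p.Carrier) x y
theorem mk_zero : mk p 0 = 0 := rfl
theorem mk_one : mk p 1 = 1 := rfl
theorem mk_algebraMap (c : ℂ) : mk p (algebraMap ℂ A c) = algebraMap ℂ p.Completion c := rfl

theorem star_isometry : Isometry (fun x : p.Carrier => star x) := by
  refine Isometry.of_dist_eq fun x y => ?_
  rw [dist_eq_norm, dist_eq_norm, ← star_sub]
  exact p.star_eq _

instance : Star p.Completion :=
  ⟨UniformSpace.Completion.map (fun x : p.Carrier => star x)⟩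

theorem mk_star (x : A) : mk p (star x) = star (mk p x) :=
  (UniformSpace.Completion.map_coe (star_isometry p).uniformContinuous (show p.Carrier from x)).symm

theorem continuous_star' : Continuous (star : p.Completion → p.Completion) :=
  UniformSpace.Completion.continuous_map

instance : StarRing p.Completion where
  star_involutive x := by
    refine (denseRange_mk p).induction_on (p := fun x => star (star x) = x) x
      (isClosed_eq ((continuous_star' p).comp (continuous_star' p)) continuous_id) fun a => ?_
    rw [← mk_star, ← mk_star, star_star]
  star_mul x y := by
    have h1 := continuous_star' p
    refine (denseRange_mk p).induction_on₂ (p := fun x y => star (x * y) = star y * star x)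
      (isClosed_eq (by fun_prop) (by fun_prop)) (fun a b => ?_) x y
    rw [← mk_mul, ← mk_star, ← mk_star, ← mk_star, star_mul, mk_mul]
  star_add x y := by
    have h1 := continuous_star' p
    refine (denseRange_mk p).induction_on₂ (p := fun x y => star (x + y) = star x + star y)
      (isClosed_eq (by fun_prop) (by fun_prop)) (fun a b => ?_) x y
    rw [← mk_add, ← mk_star, ← mk_star, ← mk_star, star_add, mk_add]

theorem mk_smul (c : ℂ) (x : A) : mk p (c • x) = c • mk p x := by
  rw [Algebra.smul_def, Algebra.smul_def, mk_mul, mk_algebraMap]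

instance [StarModule ℂ A] : CStarAlgebra p.Completion where
  norm_mul_self_le x := by
    have h1 := continuous_star' p
    refine (denseRange_mk p).induction_on (p := fun x => ‖x‖ * ‖x‖ ≤ ‖star x * x‖) x
      (isClosed_le (by fun_prop) (by fun_prop)) fun a => ?_
    rw [← mk_star, ← mk_mul, norm_mk, norm_mk]
    exact p.mul_self_le a
  star_smul c x := by
    have h1 := continuous_star' p
    refine (denseRange_mk p).induction_on (p := fun x => star (c • x) = star c • star x) x
      (isClosed_eq (h1.comp (continuous_const_smul c)) (h1.const_smul (star c))) fun a => ?_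
    rw [← mk_star, ← mk_smul, ← mk_smul, ← mk_star, star_smul]

/-- The canonical *-homomorphism `A → p.Completion`; it has dense range and `‖of p x‖ = p x`. -/
def of : A →⋆ₐ[ℂ] p.Completion where
  toFun := mk p
  map_one' := mk_one p
  map_mul' := mk_mul p
  map_zero' := mk_zero p
  map_add' := mk_add p
  commutes' := mk_algebraMap p
  map_star' := mk_star p

theorem denseRange_of : DenseRange (of p) := denseRange_mk p

@[simp] theorem norm_of (x : A) : ‖of p x‖ = p x := norm_mk p x

variable {p}
variable {B : Type*} [CStarAlgebra B]

theorem _root_.StarAlgHom.continuous_cstar {C D : Type*} [CStarAlgebra C] [CStarAlgebra D]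
    (f : C →⋆ₐ[ℂ] D) : Continuous f := by
  refine AddMonoidHomClass.continuous_of_bound f 1 fun x => ?_
  rw [one_mul]
  exact NonUnitalStarAlgHom.norm_apply_le f x

/-- A *-homomorphism out of the completion is determined on the dense image of `A`. -/
theorem hom_ext [StarModule ℂ A] {f g : p.Completion →⋆ₐ[ℂ] B} (h : ∀ x, f (of p x) = g (of p x)) : f = g := by
  refine StarAlgHom.ext fun x => ?_
  exact congrFun ((denseRange_of p).equalizer f.continuous_cstar g.continuous_cstar
    (funext h)) x

/-- A *-homomorphism from `A` to a C*-algebra that is dominated by `p` extends to the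
completion. -/
def lift (f : A →⋆ₐ[ℂ] B) (hf : ∀ x, ‖f x‖ ≤ p x) : p.Completion →⋆ₐ[ℂ] B :=
  let f' : p.Carrier →+* B := (f : A →+* B)
  have hc : Continuous f' := AddMonoidHomClass.continuous_of_bound f' 1 fun x => by
    rw [one_mul]; exact hf x
  let F : p.Completion →+* B := UniformSpace.Completion.extensionHom f' hc
  have hF : Continuous F := UniformSpace.Completion.continuous_extension
  have hFm : ∀ x : A, F (mk p x) = f x := fun x => UniformSpace.Completion.extensionHom_coe f' hc x
  { toFun := F
    map_one' := map_one F
    map_mul' := map_mul F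
    map_zero' := map_zero F
    map_add' := map_add F
    commutes' := fun c => by
      have := hFm (algebraMap ℂ A c)
      rw [AlgHomClass.commutes] at this
      exact this
    map_star' := fun x => by
      have h1 := continuous_star' p
      refine (denseRange_mk p).induction_on (p := fun x => F (star x) = star (F x)) x
        (isClosed_eq (hF.comp h1) (continuous_star.comp hF)) fun a => ?_
      rw [← mk_star, hFm, hFm, map_star] }

@[simp] theorem lift_of (f : A →⋆ₐ[ℂ] B) (hf : ∀ x, ‖f x‖ ≤ p x) (x : A) :
    lift f hf (of p x) = f x :=
  UniformSpace.Completion.extensionHom_coe (α := p.Carrier) (f : A →+* B)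
    (AddMonoidHomClass.continuous_of_bound (show p.Carrier →+* B from (f : A →+* B)) 1
      fun x => by rw [one_mul]; exact hf x) x

end Completion

end Completion

end CStarSeminorm

/-! ### The Toeplitz algebra -/

/-- The free unital complex *-algebra on one generator `s`: the monoid algebra of the words in
two letters, `true` standing for `s` and `false` standing for `s*`. -/
def FreeStarAlgebra : Type := MonoidAlgebra ℂ (FreeMonoid Bool)

namespace FreeStarAlgebra

instance : Ring FreeStarAlgebra := inferInstanceAs (Ring (MonoidAlgebra ℂ (FreeMonoid Bool)))
instance : Algebra ℂ FreeStarAlgebra :=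
  inferInstanceAs (Algebra ℂ (MonoidAlgebra ℂ (FreeMonoid Bool)))

/-- The adjoint of a word: reverse it and exchange the two letters. -/
def wordStar (w : FreeMonoid Bool) : FreeMonoid Bool :=
  FreeMonoid.ofList ((w.toList.map not).reverse)

theorem wordStar_wordStar (w : FreeMonoid Bool) : wordStar (wordStar w) = w := by
  simp [wordStar, Function.comp_def]

theorem wordStar_mul (v w : FreeMonoid Bool) : wordStar (v * w) = wordStar w * wordStar v := by
  simp [wordStar]

theorem wordStar_one : wordStar 1 = 1 := rfl

/-- The element `c • w` of the free *-algebra, for a word `w` and a scalar `c`. -/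
def single (w : FreeMonoid Bool) (c : ℂ) : FreeStarAlgebra := MonoidAlgebra.single w c

theorem single_mul (v w : FreeMonoid Bool) (c d : ℂ) :
    single v c * single w d = single (v * w) (c * d) :=
  MonoidAlgebra.single_mul_single v w c d

theorem induction {P : FreeStarAlgebra → Prop} (x : FreeStarAlgebra) (h0 : P 0)
    (hadd : ∀ x y, P x → P y → P (x + y)) (h1 : ∀ w c, P (single w c)) : P x :=
  MonoidAlgebra.induction_linear (motive := P) x h0 (fun x y => hadd x y) h1

/-- The conjugate-linear map with `w ↦ w*` on words. -/
def starAdd : FreeStarAlgebra →+ FreeStarAlgebra where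
  toFun x := MonoidAlgebra.ofCoeff
    ((Finsupp.mapRange.addMonoidHom (starRingEnd ℂ : ℂ →+ ℂ) (MonoidAlgebra.coeff x)).mapDomain
      wordStar)
  map_zero' := by
    change MonoidAlgebra.ofCoeff ((Finsupp.mapRange.addMonoidHom (starRingEnd ℂ : ℂ →+ ℂ)
      0).mapDomain wordStar) = _
    rw [map_zero, Finsupp.mapDomain_zero]; rfl
  map_add' x y := by
    change MonoidAlgebra.ofCoeff ((Finsupp.mapRange.addMonoidHom (starRingEnd ℂ : ℂ →+ ℂ)
      (MonoidAlgebra.coeff x + MonoidAlgebra.coeff y)).mapDomain wordStar) = _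
    rw [map_add, Finsupp.mapDomain_add]; rfl

theorem starAdd_single (w : FreeMonoid Bool) (c : ℂ) :
    starAdd (single w c) = single (wordStar w) (conj c) := by
  change MonoidAlgebra.ofCoeff ((Finsupp.mapRange.addMonoidHom (starRingEnd ℂ : ℂ →+ ℂ)
      (Finsupp.single w c)).mapDomain wordStar) = _
  rw [Finsupp.mapRange.addMonoidHom_apply, Finsupp.mapRange_single, Finsupp.mapDomain_single]
  rfl

instance : StarRing FreeStarAlgebra where
  star := starAdd
  star_involutive x := by
    refine induction (P := fun x => starAdd (starAdd x) = x) x (by simp)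
      (fun x y hx hy => by simp [hx, hy]) fun w c => ?_
    rw [starAdd_single, starAdd_single, wordStar_wordStar, Complex.conj_conj]
  star_mul x y := by
    change starAdd (x * y) = starAdd y * starAdd x
    refine induction (P := fun x => starAdd (x * y) = starAdd y * starAdd x) x (by simp)
      (fun x x' hx hx' => by rw [add_mul, map_add, map_add, hx, hx', mul_add]) fun v c => ?_
    refine induction (P := fun y => starAdd (single v c * y) = starAdd y * starAdd (single v c)) y
      (by simp) (fun y y' hy hy' => by rw [mul_add, map_add, map_add, hy, hy', add_mul])
      fun w d => ?_
    rw [single_mul, starAdd_single, starAdd_single, starAdd_single, single_mul, wordStar_mul,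
      map_mul, mul_comm]
  star_add := starAdd.map_add

theorem star_single (w : FreeMonoid Bool) (c : ℂ) :
    star (single w c) = single (wordStar w) (conj c) := starAdd_single w c

theorem smul_single (z : ℂ) (w : FreeMonoid Bool) (c : ℂ) :
    z • single w c = single w (z * c) := MonoidAlgebra.smul_single z w c

instance : StarModule ℂ FreeStarAlgebra where
  star_smul z x := by
    refine induction (P := fun x => star (z • x) = star z • star x) x (by simp)
      (fun x y hx hy => by rw [smul_add, star_add, hx, hy, star_add, smul_add]) fun w c => ?_
    rw [smul_single, star_single, star_single, smul_single, map_mul]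
    rfl

/-- The generator `s`. -/
def gen : FreeStarAlgebra := single (FreeMonoid.of true) 1

theorem star_gen : star gen = single (FreeMonoid.of false) 1 := by
  rw [gen, star_single, map_one]; rfl

theorem single_one_one : single 1 1 = 1 := rfl

/-- Every element is obtained from the generator by the *-algebra operations. -/
theorem induction_gen {P : FreeStarAlgebra → Prop} (x : FreeStarAlgebra)
    (halg : ∀ c : ℂ, P (algebraMap ℂ _ c)) (hgen : P gen) (hstar : ∀ x, P x → P (star x))
    (hadd : ∀ x y, P x → P y → P (x + y)) (hmul : ∀ x y, P x → P y → P (x * y)) : P x := by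
  refine induction x (by simpa using halg 0) hadd fun w c => ?_
  have hw : P (single w 1) := by
    induction w using FreeMonoid.inductionOn' with
    | one => rw [single_one_one]; simpa using halg 1
    | of_mul b w ih =>
      have : single (FreeMonoid.of b * w) 1 = single (FreeMonoid.of b) 1 * single w 1 := by
        rw [single_mul, one_mul]
      rw [this]
      refine hmul _ _ ?_ ih
      cases b
      · rw [← star_gen]; exact hstar _ hgen
      · exact hgen
  have : single w c = algebraMap ℂ _ c * single w 1 := by
    rw [← Algebra.smul_def, smul_single, mul_one]
  rw [this]
  exact hmul _ _ (halg c) hw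

variable {B : Type*} [Ring B] [Algebra ℂ B] [StarRing B] [StarModule ℂ B]

/-- The *-homomorphism that sends the generator to a given element `v`. -/
def lift (v : B) : FreeStarAlgebra →⋆ₐ[ℂ] B :=
  let F : FreeStarAlgebra →ₐ[ℂ] B := MonoidAlgebra.lift ℂ B (FreeMonoid Bool)
    (FreeMonoid.lift fun b => if b then v else star v)
  { F with
    map_star' := fun x => by
      change F (star x) = star (F x)
      have hF : ∀ w c, F (single w c) = c • FreeMonoid.lift (fun b => if b then v else star v) w :=
        fun w c => MonoidAlgebra.lift_single _ _ _
      refine induction (P := fun x => F (star x) = star (F x)) x (by simp)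
        (fun x y hx hy => by simp only [star_add, map_add, hx, hy]) fun w c => ?_
      rw [star_single, hF, hF, star_smul]
      congr 1
      induction w using FreeMonoid.inductionOn' with
      | one => rw [wordStar_one, map_one, star_one]
      | of_mul b w ih =>
        rw [wordStar_mul, map_mul, map_mul, star_mul, ih]
        congr 1
        cases b <;> simp [wordStar] }

@[simp] theorem lift_gen (v : B) : lift v gen = v := by
  change MonoidAlgebra.lift ℂ B (FreeMonoid Bool) _ (MonoidAlgebra.single _ _) = _
  rw [MonoidAlgebra.lift_single]
  simp

end FreeStarAlgebra

open FreeStarAlgebra in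
/-- The C*-seminorms on the free *-algebra for which the generator is an isometry. -/
structure ToeplitzIndex : Type where
  val : CStarSeminorm FreeStarAlgebra
  isometry : val (star gen * gen - 1) = 0

namespace Toeplitz

open FreeStarAlgebra

theorem index_gen_le (p : ToeplitzIndex) : p.val gen ≤ 1 := by
  have h1 : p.val 1 ≤ 1 := by
    by_contra h
    push Not at h
    have := p.val.mul_self_le 1
    rw [star_one, one_mul] at this
    nlinarith
  have h2 : p.val (star gen * gen) ≤ 1 := by
    have : star gen * gen = (star gen * gen - 1) + 1 := by abel
    rw [this]
    refine (map_add_le_add p.val.toSeminorm _ _).trans ?_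
    rw [p.isometry, zero_add]
    exact h1
  by_contra h
  push Not at h
  have := p.val.mul_self_le gen
  nlinarith

theorem bounded (x : FreeStarAlgebra) :
    BddAbove (Set.range fun p : ToeplitzIndex => p.val x) := by
  suffices h : ∃ C, ∀ p : ToeplitzIndex, p.val x ≤ C by
    obtain ⟨C, hC⟩ := h
    exact ⟨C, by rintro _ ⟨p, rfl⟩; exact hC p⟩
  refine induction_gen (P := fun x => ∃ C, ∀ p : ToeplitzIndex, p.val x ≤ C) x (fun c => ?_)
    ⟨1, index_gen_le⟩ ?_ ?_ ?_
  · refine ⟨‖c‖, fun p => ?_⟩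
    rw [Algebra.algebraMap_eq_smul_one, map_smul_eq_mul]
    have h1 : p.val 1 ≤ 1 := by
      by_contra h
      push Not at h
      have := p.val.mul_self_le 1
      rw [star_one, one_mul] at this
      nlinarith
    exact mul_le_of_le_one_right (norm_nonneg c) h1
  · rintro x ⟨C, hC⟩
    exact ⟨C, fun p => by rw [p.val.star_eq]; exact hC p⟩
  · rintro x y ⟨C, hC⟩ ⟨D, hD⟩
    exact ⟨C + D, fun p => (map_add_le_add p.val.toSeminorm x y).trans (add_le_add (hC p) (hD p))⟩
  · rintro x y ⟨C, hC⟩ ⟨D, hD⟩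
    refine ⟨C * D, fun p => (p.val.mul_le x y).trans ?_⟩
    exact mul_le_mul (hC p) (hD p) (p.val.nonneg y) ((p.val.nonneg x).trans (hC p))

/-- The largest C*-seminorm on the free *-algebra for which the generator is an isometry. -/
def seminorm : CStarSeminorm FreeStarAlgebra :=
  CStarSeminorm.iSup (fun p : ToeplitzIndex => p.val) bounded

end Toeplitz

/-- The Toeplitz algebra: the universal unital C*-algebra generated by one isometry. -/
def Toeplitz : Type := Toeplitz.seminorm.Completion

namespace Toeplitz

open FreeStarAlgebra

instance : CStarAlgebra Toeplitz := inferInstanceAs (CStarAlgebra Toeplitz.seminorm.Completion)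

/-- The canonical map of the free *-algebra into the Toeplitz algebra. -/
def of : FreeStarAlgebra →⋆ₐ[ℂ] Toeplitz := CStarSeminorm.Completion.of seminorm

theorem denseRange_of : DenseRange of := CStarSeminorm.Completion.denseRange_of seminorm

/-- The generating isometry. -/
def s : Toeplitz := of gen

theorem star_s_mul_s : star s * s = 1 := by
  have h : ‖of (star gen * gen - 1)‖ = 0 := by
    refine le_antisymm ?_ (norm_nonneg _)
    refine (CStarSeminorm.Completion.norm_of seminorm _).le.trans ?_
    exact CStarSeminorm.iSup_le _ _ le_rfl fun p => p.isometry.le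
  rw [norm_eq_zero, map_sub, map_mul, map_star, map_one, sub_eq_zero] at h
  exact h

/-- A closed *-subalgebra that contains the generating isometry is everything. -/
theorem mem_of_s_mem (S : StarSubalgebra ℂ Toeplitz) (hS : IsClosed (S : Set Toeplitz))
    (hs : s ∈ S) (x : Toeplitz) : x ∈ S := by
  refine denseRange_of.induction_on (p := fun x => x ∈ S) x hS fun a => ?_
  refine induction_gen (P := fun a => of a ∈ S) a (fun c => ?_) hs (fun x hx => ?_)
    (fun x y hx hy => ?_) (fun x y hx hy => ?_)
  · rw [AlgHomClass.commutes]; exact algebraMap_mem S c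
  · rw [map_star]; exact star_mem hx
  · rw [map_add]; exact add_mem hx hy
  · rw [map_mul]; exact mul_mem hx hy

variable {B : Type*} [CStarAlgebra B]

/-- The universal property, existence: for an isometry `v` in a unital C*-algebra there is a
unital *-homomorphism that sends `s` to `v`. -/
def lift (v : B) (hv : star v * v = 1) : Toeplitz →⋆ₐ[ℂ] B :=
  CStarSeminorm.Completion.lift (FreeStarAlgebra.lift v) fun x =>
    CStarSeminorm.le_iSup (fun p : ToeplitzIndex => p.val) bounded
      ⟨CStarSeminorm.ofHom (FreeStarAlgebra.lift v), by
        rw [CStarSeminorm.ofHom_apply, map_sub, map_mul, map_star, map_one,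
          FreeStarAlgebra.lift_gen, hv, sub_self, norm_zero]⟩ x

@[simp] theorem lift_s (v : B) (hv : star v * v = 1) : lift v hv s = v := by
  refine (CStarSeminorm.Completion.lift_of _ _ gen).trans ?_
  exact FreeStarAlgebra.lift_gen v

/-- The universal property, uniqueness. -/
theorem hom_ext {f g : Toeplitz →⋆ₐ[ℂ] B} (h : f s = g s) : f = g := by
  refine StarAlgHom.ext fun x => ?_
  refine mem_of_s_mem (StarAlgHom.equalizer f g) ?_ h x
  exact isClosed_eq f.continuous_cstar g.continuous_cstar

end Toeplitz

/-! ### The minimal (spatial) tensor product -/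

universe u v

/-- A pair of unital *-representations of `A` and `B` on Hilbert spaces `H` and `K`. -/
structure RepPair (A : Type u) (B : Type v) [CStarAlgebra A] [CStarAlgebra B] where
  H : Type u
  K : Type v
  [normedH : NormedAddCommGroup H]
  [innerH : InnerProductSpace ℂ H]
  [completeH : CompleteSpace H]
  [normedK : NormedAddCommGroup K]
  [innerK : InnerProductSpace ℂ K]
  [completeK : CompleteSpace K]
  ρ : A →⋆ₐ[ℂ] (H →L[ℂ] H)
  τ : B →⋆ₐ[ℂ] (K →L[ℂ] K)

namespace RepPair

variable {A : Type u} {B : Type v} [CStarAlgebra A] [CStarAlgebra B] (r : RepPair A B)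

instance : NormedAddCommGroup r.H := r.normedH
instance : InnerProductSpace ℂ r.H := r.innerH
instance : CompleteSpace r.H := r.completeH
instance : NormedAddCommGroup r.K := r.normedK
instance : InnerProductSpace ℂ r.K := r.innerK
instance : CompleteSpace r.K := r.completeK

/-- The algebraic tensor product of the Hilbert spaces `H` and `K`, with the inner product
`⟪h ⊗ k, h' ⊗ k'⟫ = ⟪h, h'⟫ ⟪k, k'⟫`: a dense subspace of the Hilbert space tensor product. -/
def Space : Type (max u v) := r.H ⊗[ℂ] r.K

instance : NormedAddCommGroup r.Space := inferInstanceAs (NormedAddCommGroup (r.H ⊗[ℂ] r.K))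
instance : InnerProductSpace ℂ r.Space := inferInstanceAs (InnerProductSpace ℂ (r.H ⊗[ℂ] r.K))

/-- The operator `S ⊗ T` on `H ⊗ K`. -/
def opTensor (S : r.H →L[ℂ] r.H) (T : r.K →L[ℂ] r.K) : r.Space →L[ℂ] r.Space :=
  TensorProduct.mapL S T

theorem norm_opTensor_le (S : r.H →L[ℂ] r.H) (T : r.K →L[ℂ] r.K) :
    ‖r.opTensor S T‖ ≤ ‖S‖ * ‖T‖ := TensorProduct.norm_mapL_le S T

/-- The representation `ρ ⊗ τ` of the algebraic tensor product, `(ρ ⊗ τ)(a ⊗ b) = ρ a ⊗ τ b`.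
Since `r.Space` is dense in the Hilbert space tensor product, the operator norm of `(ρ ⊗ τ) x` is
that of its extension to the Hilbert space tensor product. -/
def tensorRep : A ⊗[ℂ] B →ₐ[ℂ] (r.Space →L[ℂ] r.Space) :=
  Algebra.TensorProduct.algHomOfLinearMapTensorProduct
    (TensorProduct.lift (LinearMap.mk₂ ℂ (fun a b => r.opTensor (r.ρ a) (r.τ b))
      (fun a a' b => by rw [map_add]; exact TensorProduct.mapL_add_left _ _ _)
      (fun c a b => by rw [map_smul]; exact TensorProduct.mapL_smul_left _ _ _)
      (fun a b b' => by rw [map_add]; exact TensorProduct.mapL_add_right _ _ _)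
      (fun c a b => by rw [map_smul]; exact TensorProduct.mapL_smul_right _ _ _)))
    (fun a a' b b' => by
      simp only [TensorProduct.lift.tmul, LinearMap.mk₂_apply, map_mul]
      exact TensorProduct.mapL_mul _ _ _ _)
    (by
      simp only [TensorProduct.lift.tmul, LinearMap.mk₂_apply, map_one]
      exact TensorProduct.mapL_id_id)

@[simp] theorem tensorRep_tmul (a : A) (b : B) :
    r.tensorRep (a ⊗ₜ b) = r.opTensor (r.ρ a) (r.τ b) := rfl

theorem inner_opTensor {S S' : r.H →L[ℂ] r.H} {T T' : r.K →L[ℂ] r.K}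
    (hS : ∀ h h', inner ℂ (S' h) h' = inner ℂ h (S h'))
    (hT : ∀ k k', inner ℂ (T' k) k' = inner ℂ k (T k')) (y z : r.H ⊗[ℂ] r.K) :
    inner ℂ (TensorProduct.mapL S' T' y) z = inner ℂ y (TensorProduct.mapL S T z) := by
  induction y using TensorProduct.induction_on with
  | zero => simp
  | add y y' hy hy' => rw [map_add, inner_add_left, inner_add_left, hy, hy']
  | tmul h k =>
    induction z using TensorProduct.induction_on with
    | zero => simp
    | add z z' hz hz' => rw [map_add, inner_add_right, inner_add_right, hz, hz']
    | tmul h' k' =>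
      rw [TensorProduct.mapL_tmul, TensorProduct.mapL_tmul, TensorProduct.inner_tmul,
        TensorProduct.inner_tmul, hS, hT]

theorem inner_tensorRep_star (x : A ⊗[ℂ] B) (y z : r.Space) :
    inner ℂ (r.tensorRep (star x) y) z = inner ℂ y (r.tensorRep x z) := by
  induction x using TensorProduct.induction_on with
  | zero => simp
  | add x x' hx hx' =>
    rw [star_add, map_add, map_add, add_apply, add_apply, inner_add_left, inner_add_right, hx, hx']
  | tmul a b =>
    rw [TensorProduct.star_tmul, tensorRep_tmul, tensorRep_tmul]
    refine r.inner_opTensor (fun h h' => ?_) (fun k k' => ?_) y z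
    · rw [map_star, ContinuousLinearMap.star_eq_adjoint, ContinuousLinearMap.adjoint_inner_left]
    · rw [map_star, ContinuousLinearMap.star_eq_adjoint, ContinuousLinearMap.adjoint_inner_left]

theorem norm_tensorRep_mul_self_le (x : A ⊗[ℂ] B) :
    ‖r.tensorRep x‖ * ‖r.tensorRep x‖ ≤ ‖r.tensorRep (star x * x)‖ := by
  have h : ‖r.tensorRep x‖ ≤ Real.sqrt ‖r.tensorRep (star x * x)‖ := by
    refine ContinuousLinearMap.opNorm_le_bound _ (Real.sqrt_nonneg _) fun y => ?_
    suffices h0 : ‖r.tensorRep x y‖ ^ 2 ≤ ‖r.tensorRep (star x * x)‖ * ‖y‖ ^ 2 by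
      have := Real.le_sqrt_of_sq_le h0
      rwa [Real.sqrt_mul (norm_nonneg _), Real.sqrt_sq (norm_nonneg y)] at this
    have h1 : inner ℂ (r.tensorRep (star x * x) y) y =
        inner ℂ (r.tensorRep x y) (r.tensorRep x y) := by
      rw [map_mul, mul_apply_eq_comp, inner_tensorRep_star]
    have h2 : ‖r.tensorRep x y‖ ^ 2 = ‖inner ℂ (r.tensorRep (star x * x) y) y‖ := by
      rw [h1, inner_self_eq_norm_sq_to_K]; simp
    rw [h2]
    refine (norm_inner_le_norm _ _).trans ?_
    rw [sq, ← mul_assoc]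
    exact mul_le_mul_of_nonneg_right (ContinuousLinearMap.le_opNorm _ _) (norm_nonneg _)
  calc _ ≤ _ := mul_self_le_mul_self (norm_nonneg _) h
    _ = _ := Real.mul_self_sqrt (norm_nonneg _)

/-- The C*-seminorm `x ↦ ‖(ρ ⊗ τ) x‖` on the algebraic tensor product. -/
def seminorm : CStarSeminorm (A ⊗[ℂ] B) where
  toFun x := ‖r.tensorRep x‖
  map_zero' := by simp
  add_le' x y := by rw [map_add]; exact norm_add_le _ _
  neg' x := by simp
  smul' c x := by rw [map_smul, norm_smul]
  mul_le' x y := by rw [map_mul]; exact norm_mul_le _ _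
  mul_self_le' := r.norm_tensorRep_mul_self_le

theorem seminorm_apply (x : A ⊗[ℂ] B) : r.seminorm x = ‖r.tensorRep x‖ := rfl

theorem bounded (x : A ⊗[ℂ] B) :
    BddAbove (Set.range fun r : RepPair A B => r.seminorm x) := by
  suffices h : ∃ C, ∀ r : RepPair A B, r.seminorm x ≤ C by
    obtain ⟨C, hC⟩ := h
    exact ⟨C, by rintro _ ⟨p, rfl⟩; exact hC p⟩
  induction x using TensorProduct.induction_on with
  | zero => exact ⟨0, fun r => (map_zero r.seminorm.toSeminorm).le⟩
  | add x y hx hy =>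
    obtain ⟨C, hC⟩ := hx
    obtain ⟨D, hD⟩ := hy
    exact ⟨C + D, fun r =>
      (map_add_le_add r.seminorm.toSeminorm x y).trans (add_le_add (hC r) (hD r))⟩
  | tmul a b =>
    refine ⟨‖a‖ * ‖b‖, fun r => ?_⟩
    rw [seminorm_apply, tensorRep_tmul]
    exact (r.norm_opTensor_le _ _).trans (mul_le_mul
      (NonUnitalStarAlgHom.norm_apply_le r.ρ a) (NonUnitalStarAlgHom.norm_apply_le r.τ b)
      (norm_nonneg _) (norm_nonneg _))

/-- Pulling a pair of representations back along *-homomorphisms. -/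
def comap {A' : Type u} {B' : Type v} [CStarAlgebra A'] [CStarAlgebra B'] (r : RepPair A' B')
    (f : A →⋆ₐ[ℂ] A') (g : B →⋆ₐ[ℂ] B') : RepPair A B where
  H := r.H
  K := r.K
  ρ := r.ρ.comp f
  τ := r.τ.comp g

end RepPair

/-- The minimal C*-norm on the algebraic tensor product: the supremum of `‖(ρ ⊗ τ) x‖` over all
pairs of representations `ρ` of `A` and `τ` of `B` on Hilbert spaces. -/
def minSeminorm (A : Type u) (B : Type v) [CStarAlgebra A] [CStarAlgebra B] :
    CStarSeminorm (A ⊗[ℂ] B) :=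
  CStarSeminorm.iSup (fun r : RepPair A B => r.seminorm) RepPair.bounded

/-- The minimal (spatial) tensor product of unital C*-algebras. -/
def MinTensor (A : Type u) (B : Type v) [CStarAlgebra A] [CStarAlgebra B] : Type (max u v) :=
  (minSeminorm A B).Completion

infixr:70 " ⊗ᵐ " => MinTensor

namespace MinTensor

section

variable (A : Type u) (B : Type v) [CStarAlgebra A] [CStarAlgebra B]

instance : CStarAlgebra (A ⊗ᵐ B) := inferInstanceAs (CStarAlgebra (minSeminorm A B).Completion)

/-- The canonical map of the algebraic tensor product into the minimal tensor product. -/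
def of : A ⊗[ℂ] B →⋆ₐ[ℂ] A ⊗ᵐ B := CStarSeminorm.Completion.of (minSeminorm A B)

theorem denseRange_of : DenseRange (of A B) :=
  CStarSeminorm.Completion.denseRange_of (minSeminorm A B)

theorem norm_of (x : A ⊗[ℂ] B) : ‖of A B x‖ = minSeminorm A B x :=
  CStarSeminorm.Completion.norm_of _ x

end

variable {A A' A'' : Type u} {B B' B'' : Type v} [CStarAlgebra A] [CStarAlgebra A']
  [CStarAlgebra A''] [CStarAlgebra B] [CStarAlgebra B'] [CStarAlgebra B'']

/-- The elementary tensor `a ⊗ b`. -/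
def tmul (a : A) (b : B) : A ⊗ᵐ B := of A B (a ⊗ₜ b)

theorem tmul_mul_tmul (a a' : A) (b b' : B) :
    tmul a b * tmul a' b' = tmul (a * a') (b * b') := by
  rw [tmul, tmul, ← map_mul, Algebra.TensorProduct.tmul_mul_tmul]; rfl

theorem star_tmul (a : A) (b : B) : star (tmul a b) = tmul (star a) (star b) := by
  rw [tmul, ← map_star, TensorProduct.star_tmul]; rfl

theorem one_tmul_one : (tmul 1 1 : A ⊗ᵐ B) = 1 := map_one (of A B)

theorem add_tmul (a a' : A) (b : B) : tmul (a + a') b = tmul a b + tmul a' b := by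
  rw [tmul, TensorProduct.add_tmul, map_add]; rfl

theorem tmul_add (a : A) (b b' : B) : tmul a (b + b') = tmul a b + tmul a b' := by
  rw [tmul, TensorProduct.tmul_add, map_add]; rfl

theorem smul_tmul (c : ℂ) (a : A) (b : B) : tmul (c • a) b = c • tmul a b := by
  rw [tmul, ← TensorProduct.smul_tmul', map_smul]; rfl

theorem tmul_smul (c : ℂ) (a : A) (b : B) : tmul a (c • b) = c • tmul a b := by
  rw [tmul, TensorProduct.tmul_smul, map_smul]; rfl

/-- The *-homomorphism `a ↦ a ⊗ 1`. -/
def inl : A →⋆ₐ[ℂ] A ⊗ᵐ B where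
  toFun a := tmul a 1
  map_one' := one_tmul_one
  map_mul' a a' := by rw [tmul_mul_tmul, mul_one]
  map_zero' := by rw [tmul, TensorProduct.zero_tmul, map_zero]
  map_add' a a' := add_tmul a a' 1
  commutes' c := by
    rw [Algebra.algebraMap_eq_smul_one, smul_tmul, one_tmul_one, Algebra.algebraMap_eq_smul_one]
  map_star' a := by rw [star_tmul, star_one]

/-- The *-homomorphism `b ↦ 1 ⊗ b`. -/
def inr : B →⋆ₐ[ℂ] A ⊗ᵐ B where
  toFun b := tmul 1 b
  map_one' := one_tmul_one
  map_mul' a a' := by rw [tmul_mul_tmul, mul_one]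
  map_zero' := by rw [tmul, TensorProduct.tmul_zero, map_zero]
  map_add' a a' := tmul_add 1 a a'
  commutes' c := by
    rw [Algebra.algebraMap_eq_smul_one, tmul_smul, one_tmul_one, Algebra.algebraMap_eq_smul_one]
  map_star' a := by rw [star_tmul, star_one]

theorem tmul_eq (a : A) (b : B) : (tmul a b : A ⊗ᵐ B) = inl a * inr b := by
  change _ = tmul a 1 * tmul 1 b
  rw [tmul_mul_tmul, one_mul, mul_one]

/-- A closed additive subset that contains the elementary tensors is everything. -/
theorem induction {P : A ⊗ᵐ B → Prop} (x : A ⊗ᵐ B) (hcl : IsClosed {x | P x})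
    (htmul : ∀ a b, P (tmul a b)) (hadd : ∀ x y, P x → P y → P (x + y)) : P x := by
  refine (denseRange_of A B).induction_on (p := P) x hcl fun y => ?_
  induction y using TensorProduct.induction_on with
  | zero => rw [← TensorProduct.zero_tmul A (0 : B)]; exact htmul 0 0
  | add y z hy hz => rw [map_add]; exact hadd _ _ hy hz
  | tmul a b => exact htmul a b

theorem hom_ext {C : Type*} [CStarAlgebra C] {f g : A ⊗ᵐ B →⋆ₐ[ℂ] C}
    (h : ∀ a b, f (tmul a b) = g (tmul a b)) : f = g := by
  refine StarAlgHom.ext fun x => ?_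
  refine induction (P := fun x => f x = g x) x
    (isClosed_eq f.continuous_cstar g.continuous_cstar) h fun x y hx hy => ?_
  rw [map_add, map_add, hx, hy]

/-- The algebraic tensor product of *-homomorphisms. -/
def algMap (f : A →⋆ₐ[ℂ] A') (g : B →⋆ₐ[ℂ] B') : A ⊗[ℂ] B →⋆ₐ[ℂ] A' ⊗[ℂ] B' :=
  { Algebra.TensorProduct.map (f : A →ₐ[ℂ] A') (g : B →ₐ[ℂ] B') with
    map_star' := fun x => by
      change Algebra.TensorProduct.map (f : A →ₐ[ℂ] A') (g : B →ₐ[ℂ] B') (star x) =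
        star (Algebra.TensorProduct.map (f : A →ₐ[ℂ] A') (g : B →ₐ[ℂ] B') x)
      induction x using TensorProduct.induction_on with
      | zero => simp
      | add x y hx hy => rw [star_add, map_add, map_add, star_add, hx, hy]
      | tmul a b => simp [TensorProduct.star_tmul, map_star] }

theorem algMap_tmul (f : A →⋆ₐ[ℂ] A') (g : B →⋆ₐ[ℂ] B') (a : A) (b : B) :
    algMap f g (a ⊗ₜ b) = f a ⊗ₜ g b := rfl

theorem tensorRep_comap (r : RepPair A' B') (f : A →⋆ₐ[ℂ] A') (g : B →⋆ₐ[ℂ] B')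
    (x : A ⊗[ℂ] B) : (r.comap f g).tensorRep x = r.tensorRep (algMap f g x) := by
  induction x using TensorProduct.induction_on with
  | zero => rw [map_zero, map_zero, map_zero]; rfl
  | add x y hx hy => rw [map_add, map_add, map_add, hx, hy]; rfl
  | tmul a b => rfl

theorem minSeminorm_algMap_le (f : A →⋆ₐ[ℂ] A') (g : B →⋆ₐ[ℂ] B') (x : A ⊗[ℂ] B) :
    minSeminorm A' B' (algMap f g x) ≤ minSeminorm A B x := by
  refine CStarSeminorm.iSup_le _ _ (CStarSeminorm.nonneg _ x) fun r => ?_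
  have h : r.seminorm (algMap f g x) = (r.comap f g).seminorm x := by
    rw [RepPair.seminorm_apply, RepPair.seminorm_apply, tensorRep_comap]; rfl
  rw [h]
  exact CStarSeminorm.le_iSup _ RepPair.bounded (r.comap f g) x

/-- The tensor product `f ⊗ g` of *-homomorphisms. -/
def map (f : A →⋆ₐ[ℂ] A') (g : B →⋆ₐ[ℂ] B') : A ⊗ᵐ B →⋆ₐ[ℂ] A' ⊗ᵐ B' :=
  CStarSeminorm.Completion.lift ((of A' B').comp (algMap f g)) fun x =>
    (norm_of A' B' (algMap f g x)).le.trans (minSeminorm_algMap_le f g x)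

@[simp] theorem map_tmul (f : A →⋆ₐ[ℂ] A') (g : B →⋆ₐ[ℂ] B') (a : A) (b : B) :
    map f g (tmul a b) = tmul (f a) (g b) :=
  CStarSeminorm.Completion.lift_of ((of A' B').comp (algMap f g)) _ (a ⊗ₜ b)

theorem map_id : map (StarAlgHom.id ℂ A) (StarAlgHom.id ℂ B) = StarAlgHom.id ℂ (A ⊗ᵐ B) :=
  hom_ext fun a b => by rw [map_tmul]; rfl

theorem map_comp (f' : A' →⋆ₐ[ℂ] A'') (g' : B' →⋆ₐ[ℂ] B'') (f : A →⋆ₐ[ℂ] A')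
    (g : B →⋆ₐ[ℂ] B') : (map f' g').comp (map f g) = map (f'.comp f) (g'.comp g) :=
  hom_ext fun a b => by
    rw [StarAlgHom.comp_apply, map_tmul, map_tmul, map_tmul]; rfl

end MinTensor

/-! ### Actions of compact groups on C*-algebras, freeness -/

/-- A strongly continuous action of a topological group `G` on a unital C*-algebra `A` by unital
*-endomorphisms `α g` with `α 1 = id` and `α (g h) = α g ∘ α h`; each `α g` is then a
*-automorphism with inverse `α g⁻¹`. -/
structure CStarAction (G : Type*) [Group G] [TopologicalSpace G]
    (A : Type*) [CStarAlgebra A] where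
  toHom : G → A →⋆ₐ[ℂ] A
  map_one' : toHom 1 = StarAlgHom.id ℂ A
  map_mul' : ∀ g h, toHom (g * h) = (toHom g).comp (toHom h)
  continuous' : ∀ a, Continuous fun g => toHom g a

namespace CStarAction

variable {G : Type*} [Group G] [TopologicalSpace G]

section

variable {A : Type*} [CStarAlgebra A]

instance : CoeFun (CStarAction G A) (fun _ => G → A →⋆ₐ[ℂ] A) := ⟨toHom⟩

/-- The coaction `δ : A → C(G, A) ≅ A ⊗ C(G)`, `δ(a)(g) = α_g(a)`. -/
def coaction (α : CStarAction G A) (a : A) : C(G, A) := ⟨fun g => α g a, α.continuous' a⟩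

/-- Freeness of an action of a compact group in the sense of Ellwood: the closed linear span of
the elements `(x ⊗ 1) δ(y)`, for `x` and `y` in `A`, is all of `A ⊗ C(G) ≅ C(G, A)`
(with the supremum norm). -/
def IsFree [CompactSpace G] (α : CStarAction G A) : Prop :=
  (Submodule.span ℂ {f : C(G, A) | ∃ x y : A,
    f = ContinuousMap.const G x * α.coaction y}).topologicalClosure = ⊤

/-- For a family of *-endomorphisms, the elements with continuous orbit map form a closed set. -/
theorem isClosed_continuous {X : Type*} [TopologicalSpace X] (φ : X → A →⋆ₐ[ℂ] A) :
    IsClosed {a | Continuous fun x => φ x a} := by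
  rw [← isSeqClosed_iff_isClosed]
  intro a b ha hab
  refine TendstoUniformly.continuous (F := fun n x => φ x (a n)) (p := Filter.atTop) ?_
    (Filter.Eventually.frequently (Filter.Eventually.of_forall ha))
  rw [Metric.tendstoUniformly_iff]
  intro ε hε
  filter_upwards [Metric.tendsto_nhds.1 hab ε hε] with n hn x
  rw [dist_eq_norm, ← map_sub]
  refine (NonUnitalStarAlgHom.norm_apply_le (φ x) _).trans_lt ?_
  rwa [← dist_eq_norm, dist_comm]

end

section Tensor

variable {A : Type u} {B : Type v} [CStarAlgebra A] [CStarAlgebra B]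

/-- The tensor product action `g ↦ α_g ⊗ β_g`. -/
def tensor (α : CStarAction G A) (β : CStarAction G B) : CStarAction G (A ⊗ᵐ B) where
  toHom g := MinTensor.map (α g) (β g)
  map_one' := by rw [α.map_one', β.map_one', MinTensor.map_id]
  map_mul' g h := by rw [α.map_mul', β.map_mul', MinTensor.map_comp]
  continuous' x := by
    refine MinTensor.induction
      (P := fun x => Continuous fun g => MinTensor.map (α g) (β g) x) x
      (isClosed_continuous _) (fun a b => ?_) fun x y hx hy => ?_
    · simp only [MinTensor.map_tmul]
      simp only [MinTensor.tmul_eq]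
      exact ((MinTensor.inl (A := A) (B := B)).continuous_cstar.comp (α.continuous' a)).mul
        ((MinTensor.inr (A := A) (B := B)).continuous_cstar.comp (β.continuous' b))
    · simp only [map_add]
      exact hx.add hy

theorem tensor_apply (α : CStarAction G A) (β : CStarAction G B) (g : G) :
    α.tensor β g = MinTensor.map (α g) (β g) := rfl

end Tensor

section Prod

variable {A B : Type*} [CStarAlgebra A] [CStarAlgebra B]

/-- The product action on `A × B`. -/
def prod (α : CStarAction G A) (β : CStarAction G B) : CStarAction G (A × B) where
  toHom g := ((α g).comp (StarAlgHom.fst ℂ A B)).prod ((β g).comp (StarAlgHom.snd ℂ A B))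
  map_one' := by rw [α.map_one', β.map_one']; rfl
  map_mul' g h := by rw [α.map_mul', β.map_mul']; rfl
  continuous' x := (α.continuous' x.1).prodMk (β.continuous' x.2)

end Prod

section Restrict

variable {A : Type*} [CStarAlgebra A]

/-- The restriction of an action to an invariant C*-subalgebra. -/
def restrict (α : CStarAction G A) (S : StarSubalgebra ℂ A) [IsClosed (S : Set A)]
    (hS : ∀ g, ∀ a ∈ S, α g a ∈ S) : CStarAction G S where
  toHom g := ((α g).comp S.subtype).codRestrict S fun a => hS g a a.2
  map_one' := by
    refine StarAlgHom.ext fun a => Subtype.ext ?_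
    change α 1 a = a
    rw [α.map_one']; rfl
  map_mul' g h := by
    refine StarAlgHom.ext fun a => Subtype.ext ?_
    change α (g * h) a = α g (α h a)
    rw [α.map_mul']; rfl
  continuous' a := (α.continuous' (a : A)).subtype_mk _

end Restrict

end CStarAction

/-- A *-homomorphism is equivariant if it intertwines the actions. -/
def IsEquivariant {G : Type*} [Group G] [TopologicalSpace G] {A B : Type*} [CStarAlgebra A]
    [CStarAlgebra B] (α : CStarAction G A) (β : CStarAction G B) (f : A →⋆ₐ[ℂ] B) : Prop :=
  ∀ g a, f (α g a) = β g (f a)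

namespace IsEquivariant

variable {G : Type*} [Group G] [TopologicalSpace G]

theorem id {A : Type*} [CStarAlgebra A] (α : CStarAction G A) :
    IsEquivariant α α (StarAlgHom.id ℂ A) := fun _ _ => rfl

theorem tensor {A A' : Type u} {B B' : Type v} [CStarAlgebra A] [CStarAlgebra A']
    [CStarAlgebra B] [CStarAlgebra B'] {α : CStarAction G A} {α' : CStarAction G A'}
    {β : CStarAction G B} {β' : CStarAction G B'} {f : A →⋆ₐ[ℂ] A'} {f' : B →⋆ₐ[ℂ] B'}
    (hf : IsEquivariant α α' f) (hf' : IsEquivariant β β' f') :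
    IsEquivariant (α.tensor β) (α'.tensor β') (MinTensor.map f f') := fun g a => by
  have h : (MinTensor.map f f').comp (α.tensor β g) =
      (α'.tensor β' g).comp (MinTensor.map f f') := by
    rw [CStarAction.tensor_apply, CStarAction.tensor_apply, MinTensor.map_comp,
      MinTensor.map_comp]
    congr 1
    · exact StarAlgHom.ext (hf g)
    · exact StarAlgHom.ext (hf' g)
  exact DFunLike.congr_fun h a

end IsEquivariant

/-! ### The circle, the gauge action and the symbol map -/

/-- The C*-algebra `C(S¹)` of continuous functions on the unit circle. -/
abbrev CircleAlgebra : Type := C(Circle, ℂ)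

/-- The generating unitary `u` of `C(S¹)`: the inclusion of the unit circle into `ℂ`. -/
def circleU : CircleAlgebra := ⟨fun z => (z : ℂ), by fun_prop⟩

theorem star_circleU_mul : star circleU * circleU = 1 := by
  ext z
  change conj (z : ℂ) * (z : ℂ) = 1
  rw [mul_comm, Complex.mul_conj, Circle.normSq_coe, Complex.ofReal_one]

/-- The action of `U(1)` on `C(S¹) = C(U(1))` given by the comultiplication,
`(g · f)(z) = f(z g)`; so `g · u = g u`. -/
def circleAction : CStarAction Circle CircleAlgebra where
  toHom g := ContinuousMap.compStarAlgHom' ℂ ℂ (ContinuousMap.mulRight g)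
  map_one' := by
    refine StarAlgHom.ext fun f => ContinuousMap.ext fun z => ?_
    change f (z * 1) = f z
    rw [mul_one]
  map_mul' g h := by
    refine StarAlgHom.ext fun f => ContinuousMap.ext fun z => ?_
    change f (z * (g * h)) = f (z * g * h)
    rw [mul_assoc]
  continuous' f := by
    refine ContinuousMap.continuous_of_continuous_uncurry _ ?_
    change Continuous fun p : Circle × Circle => f (p.2 * p.1)
    fun_prop

theorem circleAction_circleU (g : Circle) : circleAction g circleU = (g : ℂ) • circleU := by
  ext z
  change ((z * g : Circle) : ℂ) = (g : ℂ) * (z : ℂ)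
  rw [Circle.coe_mul, mul_comm]

namespace Toeplitz

theorem gauge_isometry (g : Circle) : star ((g : ℂ) • s) * ((g : ℂ) • s) = 1 := by
  rw [star_smul, smul_mul_smul_comm, star_s_mul_s]
  change (conj (g : ℂ) * (g : ℂ)) • (1 : Toeplitz) = 1
  rw [mul_comm, Complex.mul_conj, Circle.normSq_coe, Complex.ofReal_one, one_smul]

/-- The gauge action of `U(1)` on the Toeplitz algebra, `g · s = g s`. -/
def gaugeAction : CStarAction Circle Toeplitz where
  toHom g := lift ((g : ℂ) • s) (gauge_isometry g)
  map_one' := hom_ext (by rw [lift_s, Circle.coe_one, one_smul]; rfl)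
  map_mul' g h := hom_ext (by
    rw [StarAlgHom.comp_apply, lift_s, lift_s, map_smul, lift_s, smul_smul, Circle.coe_mul,
      mul_comm])
  continuous' a := by
    let φ : Circle → Toeplitz →⋆ₐ[ℂ] Toeplitz := fun g => lift ((g : ℂ) • s) (gauge_isometry g)
    let S : StarSubalgebra ℂ Toeplitz :=
      { carrier := {a | Continuous fun g => φ g a}
        mul_mem' := fun {a b} ha hb => by
          simp only [Set.mem_ofPred_eq, map_mul] at *; exact ha.mul hb
        add_mem' := fun {a b} ha hb => by
          simp only [Set.mem_ofPred_eq, map_add] at *; exact ha.add hb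
        algebraMap_mem' := fun c => by
          simp only [Set.mem_ofPred_eq, AlgHomClass.commutes]; exact continuous_const
        star_mem' := fun {a} ha => by
          simp only [Set.mem_ofPred_eq, map_star] at *; exact ha.star }
    refine mem_of_s_mem S (CStarAction.isClosed_continuous φ) ?_ a
    change Continuous fun g : Circle => φ g s
    simp only [φ, lift_s]
    fun_prop

theorem gaugeAction_s (g : Circle) : gaugeAction g s = (g : ℂ) • s := lift_s _ (gauge_isometry g)

/-- The symbol map `σ : 𝒯 → C(S¹)`, `σ(s) = u`. -/
def symbol : Toeplitz →⋆ₐ[ℂ] CircleAlgebra := lift circleU star_circleU_mul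

theorem symbol_s : symbol s = circleU := lift_s _ _

theorem symbol_equivariant : IsEquivariant gaugeAction circleAction symbol := fun g a => by
  have h : symbol.comp (gaugeAction g) = (circleAction g).comp symbol := hom_ext (by
    rw [StarAlgHom.comp_apply, StarAlgHom.comp_apply, gaugeAction_s, map_smul, symbol_s,
      circleAction_circleU])
  exact DFunLike.congr_fun h a

end Toeplitz

/-! ### The Heegaard quantum 5-sphere -/

/-- The triple-pullback C*-algebra of a family `πⁱⱼ : Bᵢ → Bᵢⱼ = Bⱼᵢ`, `i ≠ j` in `{0, 1, 2}`: the
triples `(b₀, b₁, b₂)` with `πⁱⱼ(bᵢ) = πʲᵢ(bⱼ)` for all `i ≠ j`. -/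
def triplePullback {B₀ B₁ B₂ B₀₁ B₀₂ B₁₂ : Type*} [CStarAlgebra B₀] [CStarAlgebra B₁]
    [CStarAlgebra B₂] [CStarAlgebra B₀₁] [CStarAlgebra B₀₂] [CStarAlgebra B₁₂]
    (p₀₁ : B₀ →⋆ₐ[ℂ] B₀₁) (p₁₀ : B₁ →⋆ₐ[ℂ] B₀₁) (p₀₂ : B₀ →⋆ₐ[ℂ] B₀₂) (p₂₀ : B₂ →⋆ₐ[ℂ] B₀₂)
    (p₁₂ : B₁ →⋆ₐ[ℂ] B₁₂) (p₂₁ : B₂ →⋆ₐ[ℂ] B₁₂) : StarSubalgebra ℂ (B₀ × B₁ × B₂) where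
  carrier := {b | p₀₁ b.1 = p₁₀ b.2.1 ∧ p₀₂ b.1 = p₂₀ b.2.2 ∧ p₁₂ b.2.1 = p₂₁ b.2.2}
  mul_mem' {a b} ha hb := by
    simp only [Set.mem_ofPred_eq, Prod.fst_mul, Prod.snd_mul, map_mul] at *
    exact ⟨by rw [ha.1, hb.1], by rw [ha.2.1, hb.2.1], by rw [ha.2.2, hb.2.2]⟩
  add_mem' {a b} ha hb := by
    simp only [Set.mem_ofPred_eq, Prod.fst_add, Prod.snd_add, map_add] at *
    exact ⟨by rw [ha.1, hb.1], by rw [ha.2.1, hb.2.1], by rw [ha.2.2, hb.2.2]⟩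
  algebraMap_mem' c := by
    simp only [Set.mem_ofPred_eq, Prod.algebraMap_apply, AlgHomClass.commutes, and_self]
  star_mem' {a} ha := by
    simp only [Set.mem_ofPred_eq, Prod.fst_star, Prod.snd_star, map_star] at *
    exact ⟨by rw [ha.1], by rw [ha.2.1], by rw [ha.2.2]⟩

namespace HeegaardSphere

open Toeplitz

/-- `B₀ = C(S¹) ⊗ 𝒯 ⊗ 𝒯` -/
abbrev B₀ : Type := CircleAlgebra ⊗ᵐ Toeplitz ⊗ᵐ Toeplitz
/-- `B₁ = 𝒯 ⊗ C(S¹) ⊗ 𝒯` -/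
abbrev B₁ : Type := Toeplitz ⊗ᵐ CircleAlgebra ⊗ᵐ Toeplitz
/-- `B₂ = 𝒯 ⊗ 𝒯 ⊗ C(S¹)` -/
abbrev B₂ : Type := Toeplitz ⊗ᵐ Toeplitz ⊗ᵐ CircleAlgebra
/-- `B₀₁ = C(S¹) ⊗ C(S¹) ⊗ 𝒯` -/
abbrev B₀₁ : Type := CircleAlgebra ⊗ᵐ CircleAlgebra ⊗ᵐ Toeplitz
/-- `B₀₂ = C(S¹) ⊗ 𝒯 ⊗ C(S¹)` -/
abbrev B₀₂ : Type := CircleAlgebra ⊗ᵐ Toeplitz ⊗ᵐ CircleAlgebra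
/-- `B₁₂ = 𝒯 ⊗ C(S¹) ⊗ C(S¹)` -/
abbrev B₁₂ : Type := Toeplitz ⊗ᵐ CircleAlgebra ⊗ᵐ CircleAlgebra

/-- The tensor product `f ⊗ g ⊗ h` of three *-homomorphisms. -/
abbrev map₃ {A A' B B' C C' : Type} [CStarAlgebra A] [CStarAlgebra A'] [CStarAlgebra B]
    [CStarAlgebra B'] [CStarAlgebra C] [CStarAlgebra C'] (f : A →⋆ₐ[ℂ] A') (g : B →⋆ₐ[ℂ] B')
    (h : C →⋆ₐ[ℂ] C') : A ⊗ᵐ B ⊗ᵐ C →⋆ₐ[ℂ] A' ⊗ᵐ B' ⊗ᵐ C' :=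
  MinTensor.map f (MinTensor.map g h)

/-- The identity map of `𝒯`. -/
abbrev idT : Toeplitz →⋆ₐ[ℂ] Toeplitz := StarAlgHom.id ℂ Toeplitz
/-- The identity map of `C(S¹)`. -/
abbrev idC : CircleAlgebra →⋆ₐ[ℂ] CircleAlgebra := StarAlgHom.id ℂ CircleAlgebra

/-- The symbol map on the second factor, `B₀ → B₀₁`. -/
def p₀₁ : B₀ →⋆ₐ[ℂ] B₀₁ := map₃ idC symbol idT
/-- The symbol map on the first factor, `B₁ → B₀₁`. -/
def p₁₀ : B₁ →⋆ₐ[ℂ] B₀₁ := map₃ symbol idC idT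
/-- The symbol map on the third factor, `B₀ → B₀₂`. -/
def p₀₂ : B₀ →⋆ₐ[ℂ] B₀₂ := map₃ idC idT symbol
/-- The symbol map on the first factor, `B₂ → B₀₂`. -/
def p₂₀ : B₂ →⋆ₐ[ℂ] B₀₂ := map₃ symbol idT idC
/-- The symbol map on the third factor, `B₁ → B₁₂`. -/
def p₁₂ : B₁ →⋆ₐ[ℂ] B₁₂ := map₃ idT idC symbol
/-- The symbol map on the second factor, `B₂ → B₁₂`. -/
def p₂₁ : B₂ →⋆ₐ[ℂ] B₁₂ := map₃ idT symbol idC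

/-- The C*-algebra `C(S⁵_H)` of the Heegaard quantum 5-sphere, as a C*-subalgebra of the product
`B₀ × B₁ × B₂`. -/
def algebra : StarSubalgebra ℂ (B₀ × B₁ × B₂) := triplePullback p₀₁ p₁₀ p₀₂ p₂₀ p₁₂ p₂₁

theorem mem_algebra {b : B₀ × B₁ × B₂} : b ∈ algebra ↔
    p₀₁ b.1 = p₁₀ b.2.1 ∧ p₀₂ b.1 = p₂₀ b.2.2 ∧ p₁₂ b.2.1 = p₂₁ b.2.2 := Iff.rfl

instance isClosed_algebra : IsClosed (algebra : Set (B₀ × B₁ × B₂)) := by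
  have h1 : Continuous fun b : B₀ × B₁ × B₂ => b.2.1 := continuous_fst.comp continuous_snd
  have h2 : Continuous fun b : B₀ × B₁ × B₂ => b.2.2 := continuous_snd.comp continuous_snd
  exact (isClosed_eq (p₀₁.continuous_cstar.comp continuous_fst)
    (p₁₀.continuous_cstar.comp h1)).inter
    ((isClosed_eq (p₀₂.continuous_cstar.comp continuous_fst)
    (p₂₀.continuous_cstar.comp h2)).inter (isClosed_eq (p₁₂.continuous_cstar.comp h1)
    (p₂₁.continuous_cstar.comp h2)))

/-- The diagonal action on a triple tensor product: `α_g ⊗ β_g ⊗ γ_g`. -/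
abbrev diag₃ {A B C : Type} [CStarAlgebra A] [CStarAlgebra B] [CStarAlgebra C]
    (α : CStarAction Circle A) (β : CStarAction Circle B) (γ : CStarAction Circle C) :
    CStarAction Circle (A ⊗ᵐ B ⊗ᵐ C) := α.tensor (β.tensor γ)

/-- The diagonal `U(1)`-action on the product `B₀ × B₁ × B₂`. -/
def productAction : CStarAction Circle (B₀ × B₁ × B₂) :=
  (diag₃ circleAction gaugeAction gaugeAction).prod
    ((diag₃ gaugeAction circleAction gaugeAction).prod
      (diag₃ gaugeAction gaugeAction circleAction))

theorem productAction_mem (g : Circle) (b : B₀ × B₁ × B₂) (hb : b ∈ algebra) :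
    productAction g b ∈ algebra := by
  have hσ := symbol_equivariant
  have hT := IsEquivariant.id gaugeAction
  have hC := IsEquivariant.id circleAction
  obtain ⟨h1, h2, h3⟩ := hb
  refine ⟨?_, ?_, ?_⟩
  · exact ((hC.tensor (hσ.tensor hT)) g b.1).trans
      ((congrArg _ h1).trans ((hσ.tensor (hC.tensor hT)) g b.2.1).symm)
  · exact ((hC.tensor (hT.tensor hσ)) g b.1).trans
      ((congrArg _ h2).trans ((hσ.tensor (hT.tensor hC)) g b.2.2).symm)
  · exact ((hT.tensor (hC.tensor hσ)) g b.2.1).trans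
      ((congrArg _ h3).trans ((hT.tensor (hσ.tensor hC)) g b.2.2).symm)

/-- The diagonal `U(1)`-action on `C(S⁵_H)`. -/
def diagonalAction : CStarAction Circle algebra := productAction.restrict algebra productAction_mem

end HeegaardSphere

end

/-!
Write `A = C(S⁵_H)` and call `y ∈ A` homogeneous of degree `n` if `α_g y = gⁿ y` for all `g`.
Since `δ(y) = y ⊗ uⁿ` for such a `y`, freeness follows as soon as `1` is a finite sum of products
`x y` with `y` homogeneous of degree `1`, and also one with `y` homogeneous of degree `-1`: the
span of the elements `(x ⊗ 1) δ(y)` is then stable under multiplication by `1 ⊗ u` and by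
`1 ⊗ u*` (`CStarAction.smul_mem_freenessSpan`), so by Stone–Weierstrass its closure is a
`C(U(1))`-module (`CStarAction.isFree_of_one_mem_homogeneousProducts`). It contains `A ⊗ 1`, hence
everything, because functions `∑ hᵢ(·) aᵢ` are dense in `C(U(1), A)`
(`ContinuousMap.mem_of_smul_const_mem`, by a partition of unity).

The required elements of `A` are the three isometries `s₀, s₁, s₂` of degree `1`, where `sᵢ` has the
generating isometry (on the component `Bᵢ`, the generating unitary) in the `i`-th tensor factor.
In degree `1` one uses `1 = s₀* s₀`. In degree `-1`, the projection `1 - sᵢ sᵢ*` vanishes in the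
component `Bᵢ`, since `u` is unitary there; so the product of these three projections is zero
(`HeegaardSphere.mul_one_sub_range_eq_zero`), and expanding it writes `1` as a combination
`∑ xᵢ sᵢ*`.
-/

/-! ### Vector-valued continuous functions -/

/-- A closed additive subgroup of `C(X, E)` that contains all the functions `φ(·) v`, with `φ`
scalar and `v` a vector, is everything. -/
theorem ContinuousMap.mem_of_smul_const_mem {X E : Type*} [TopologicalSpace X] [CompactSpace X]
    [T2Space X] [NormedAddCommGroup E] [NormedSpace ℂ E] (W : AddSubgroup C(X, E))
    (hW : IsClosed (W : Set C(X, E)))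
    (h : ∀ (φ : C(X, ℂ)) (v : E), φ • ContinuousMap.const X v ∈ W) (f : C(X, E)) : f ∈ W := by
  rw [← SetLike.mem_coe, ← hW.closure_eq, Metric.mem_closure_iff]
  intro ε hε
  let U : X → Set X := fun c => {x | dist (f x) (f c) < ε / 2}
  have hU : ∀ c, IsOpen (U c) := fun c => isOpen_lt (by fun_prop) continuous_const
  obtain ⟨t, ht⟩ := isCompact_univ.elim_finite_subcover U hU fun x _ =>
    Set.mem_iUnion.2 ⟨x, by simp [U, hε]⟩
  obtain ⟨ρ, hρ⟩ := PartitionOfUnity.exists_isSubordinate (X := X) isClosed_univ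
    (fun c : t => U c) (fun c => hU c) (fun x hx => by
      obtain ⟨c, hc, hxc⟩ := Set.mem_iUnion₂.1 (ht hx)
      exact Set.mem_iUnion.2 ⟨⟨c, hc⟩, hxc⟩)
  let φ : t → C(X, ℂ) := fun c => ⟨fun x => (ρ c x : ℂ), by fun_prop⟩
  refine ⟨∑ c : t, φ c • ContinuousMap.const X (f c), sum_mem fun c _ => h _ _, ?_⟩
  refine lt_of_le_of_lt ((ContinuousMap.dist_le (half_pos hε).le).2 fun x => ?_) (half_lt_self hε)
  have hx := ρ.finsum_smul_mem_convex (Set.mem_univ x) (g := fun c _ => f c)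
    (t := Metric.closedBall (f x) (ε / 2)) (fun c hc => ?_) (convex_closedBall _ _)
  · rw [finsum_eq_sum_of_fintype, Metric.mem_closedBall, dist_comm] at hx
    rw [ContinuousMap.sum_apply]
    exact hx
  · have : x ∈ U c := hρ c (subset_tsupport _ hc)
    rw [Metric.mem_closedBall, dist_comm]
    exact (show dist (f x) (f c) < ε / 2 from this).le

theorem ContinuousMap.continuous_smul_of_algebra {X A : Type*} [TopologicalSpace X]
    [CompactSpace X] [NormedRing A] [NormedAlgebra ℂ A] :
    Continuous fun p : C(X, ℂ) × C(X, A) => p.1 • p.2 := by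
  let ι : C(ℂ, A) := ⟨algebraMap ℂ A, continuous_algebraMap ℂ A⟩
  have : (fun p : C(X, ℂ) × C(X, A) => p.1 • p.2) = fun p => ι.comp p.1 * p.2 := by
    ext p x
    exact Algebra.smul_def (p.1 x) (p.2 x)
  rw [this]
  exact ((ContinuousMap.continuous_postcomp ι).comp continuous_fst).mul continuous_snd

/-! ### A criterion for freeness -/

namespace CStarAction

variable {G : Type*} [Group G] [TopologicalSpace G] {A : Type*} [CStarAlgebra A]

/-- The linear span of the elements `(x ⊗ 1) δ(y)`, whose density is Ellwood's freeness
condition. -/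
noncomputable def freenessSpan (α : CStarAction G A) : Submodule ℂ C(G, A) :=
  Submodule.span ℂ {f : C(G, A) | ∃ x y : A, f = ContinuousMap.const G x * α.coaction y}

/-- The linear span of the products `x * y` in which `y` transforms under the action by the scalar
function `χ`. For a character `χ` this is the left ideal generated by the spectral subspace
of `χ`. -/
noncomputable def homogeneousProducts (α : CStarAction G A) (χ : C(G, ℂ)) : Submodule ℂ A :=
  Submodule.span ℂ {z : A | ∃ x y : A, (∀ g, α g y = χ g • y) ∧ z = x * y}

theorem mul_mem_homogeneousProducts (α : CStarAction G A) {χ : C(G, ℂ)} {y : A}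
    (hy : ∀ g, α g y = χ g • y) (x : A) : x * y ∈ α.homogeneousProducts χ :=
  Submodule.subset_span ⟨x, y, hy, rfl⟩

theorem const_mul_coaction_mem_freenessSpan (α : CStarAction G A) (x y : A) :
    ContinuousMap.const G x * α.coaction y ∈ α.freenessSpan :=
  Submodule.subset_span ⟨x, y, rfl⟩

/-- If `1` is a sum of products `a * b` with `b` transforming by `χ`, the span of the
`(x ⊗ 1) δ(y)` is stable under multiplication by `χ`, since
`χ • (x ⊗ 1) δ(y) = ∑ (x a ⊗ 1) δ(b y)`. -/
theorem smul_mem_freenessSpan (α : CStarAction G A) {χ : C(G, ℂ)}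
    (hχ : (1 : A) ∈ α.homogeneousProducts χ) {f : C(G, A)} (hf : f ∈ α.freenessSpan) :
    χ • f ∈ α.freenessSpan := by
  have key : ∀ x y z : A, z ∈ α.homogeneousProducts χ →
      χ • (ContinuousMap.const G (x * z) * α.coaction y) ∈ α.freenessSpan := fun x y z hz => by
    induction hz using Submodule.span_induction with
    | mem z hz =>
      obtain ⟨a, b, hb, rfl⟩ := hz
      have : χ • (ContinuousMap.const G (x * (a * b)) * α.coaction y) =
          ContinuousMap.const G (x * a) * α.coaction (b * y) := by
        ext g
        change χ g • (x * (a * b) * α g y) = x * a * α g (b * y)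
        rw [map_mul, hb, smul_mul_assoc, mul_smul_comm]
        simp only [mul_assoc]
      rw [this]
      exact α.const_mul_coaction_mem_freenessSpan _ _
    | zero =>
      convert zero_mem α.freenessSpan
      ext g
      change χ g • (x * 0 * α g y) = 0
      simp
    | add z z' _ _ hz hz' =>
      convert add_mem hz hz'
      ext g
      change χ g • (x * (z + z') * α g y) = χ g • (x * z * α g y) + χ g • (x * z' * α g y)
      rw [mul_add, add_mul, smul_add]
    | smul c z _ hz =>
      convert Submodule.smul_mem _ c hz
      ext g
      change χ g • (x * (c • z) * α g y) = c • χ g • (x * z * α g y)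
      rw [mul_smul_comm, smul_mul_assoc, smul_comm]
  induction hf using Submodule.span_induction with
  | mem f hf =>
    obtain ⟨x, y, rfl⟩ := hf
    simpa using key x y 1 hχ
  | zero => rw [smul_zero]; exact zero_mem _
  | add f f' _ _ hf hf' =>
    convert add_mem hf hf'
    ext g
    exact smul_add (χ g) (f g) (f' g)
  | smul c f _ hf =>
    convert Submodule.smul_mem _ c hf
    ext g
    exact smul_comm (χ g) c (f g)

/-- An action is free if, for some injective scalar function `χ` on the group, `1` lies in the span
of the products `x * y` with `y` transforming by `χ`, and likewise for the conjugate of `χ`. -/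
theorem isFree_of_one_mem_homogeneousProducts [CompactSpace G] [T2Space G] (α : CStarAction G A)
    {χ : C(G, ℂ)} (hinj : Function.Injective χ) (h : (1 : A) ∈ α.homogeneousProducts χ)
    (h' : (1 : A) ∈ α.homogeneousProducts (star χ)) : α.IsFree := by
  set W := α.freenessSpan.topologicalClosure with hW
  have hWcl : IsClosed (W : Set C(G, A)) := Submodule.isClosed_topologicalClosure _
  have hcont : ∀ φ : C(G, ℂ), Continuous fun f : C(G, A) => φ • f := fun φ =>
    ContinuousMap.continuous_smul_of_algebra.comp (continuous_const.prodMk continuous_id)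
  have hstab : ∀ φ : C(G, ℂ), (∀ f ∈ α.freenessSpan, φ • f ∈ α.freenessSpan) →
      ∀ f ∈ W, φ • f ∈ W := fun φ hφ f hf =>
    map_mem_closure (hcont φ) hf fun f hf => hφ f hf
  -- Stability under both `φ` and `star φ` is imposed, to get a *-subalgebra.
  let S : StarSubalgebra ℂ C(G, ℂ) :=
    { carrier := {φ | (∀ f ∈ W, φ • f ∈ W) ∧ ∀ f ∈ W, star φ • f ∈ W}
      mul_mem' := fun {φ ψ} hφ hψ => ⟨fun f hf => by
          rw [mul_smul]; exact hφ.1 _ (hψ.1 _ hf), fun f hf => by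
          rw [star_mul, mul_smul]; exact hψ.2 _ (hφ.2 _ hf)⟩
      add_mem' := fun {φ ψ} hφ hψ => ⟨fun f hf => by
          rw [add_smul]; exact add_mem (hφ.1 _ hf) (hψ.1 _ hf), fun f hf => by
          rw [star_add, add_smul]; exact add_mem (hφ.2 _ hf) (hψ.2 _ hf)⟩
      algebraMap_mem' := fun c => ⟨fun f hf => W.smul_mem c hf, fun f hf =>
        W.smul_mem (star c) hf⟩
      star_mem' := fun {φ} hφ => ⟨hφ.2, by simpa only [star_star] using hφ.1⟩ }
  have hχS : χ ∈ S := ⟨hstab χ fun f hf => α.smul_mem_freenessSpan h hf,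
    hstab (star χ) fun f hf => α.smul_mem_freenessSpan h' hf⟩
  have hSdense : S.topologicalClosure = ⊤ :=
    ContinuousMap.starSubalgebra_topologicalClosure_eq_top_of_separatesPoints S
      fun g g' hg => ⟨χ, ⟨χ, hχS, rfl⟩, hinj.ne hg⟩
  have hmod : ∀ (φ : C(G, ℂ)), ∀ f ∈ W, φ • f ∈ W := fun φ f hf => by
    have hφ : φ ∈ closure (S : Set C(G, ℂ)) := by
      rw [← StarSubalgebra.topologicalClosure_coe, hSdense]; trivial
    have hc : Continuous fun φ : C(G, ℂ) => φ • f :=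
      ContinuousMap.continuous_smul_of_algebra.comp (continuous_id.prodMk continuous_const)
    have : φ • f ∈ closure (W : Set C(G, A)) :=
      map_mem_closure (f := fun φ : C(G, ℂ) => φ • f) hc hφ fun φ hφ => hφ.1 f hf
    rwa [hWcl.closure_eq] at this
  have hconst : ∀ a : A, ContinuousMap.const G a ∈ W := fun a => by
    refine Submodule.le_topologicalClosure _ ?_
    convert α.const_mul_coaction_mem_freenessSpan a 1
    ext g
    change a = a * α g 1
    rw [map_one, mul_one]
  exact eq_top_iff.2 fun f _ => ContinuousMap.mem_of_smul_const_mem W.toAddSubgroup hWcl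
    (fun φ v => hmod φ _ (hconst v)) f

end CStarAction

/-! ### The three isometries in the algebra of the Heegaard sphere -/

/-- If `(1 - r₀ r₀*) (1 - r₁ r₁*) (1 - r₂ r₂*) = 0` then `1` is a left combination of `r₀*`, `r₁*`
and `r₂*`; this is the expansion of the product. -/
theorem one_eq_combination_of_mul_eq_zero {R : Type*} [Ring R] [StarRing R] {r₀ r₁ r₂ : R}
    (h : (1 - r₀ * star r₀) * (1 - r₁ * star r₁) * (1 - r₂ * star r₂) = 0) :
    1 = r₀ * star r₀ + (1 - r₀ * star r₀) * r₁ * star r₁ +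
      (1 - r₀ * star r₀) * (1 - r₁ * star r₁) * r₂ * star r₂ := by
  rw [← sub_eq_zero, ← h]
  noncomm_ring

theorem circleU_mul_star : circleU * star circleU = 1 := by
  rw [mul_comm, star_circleU_mul]

namespace MinTensor

universe u v

variable {A A' : Type u} {B B' : Type v} [CStarAlgebra A] [CStarAlgebra A'] [CStarAlgebra B]
  [CStarAlgebra B'] (f : A →⋆ₐ[ℂ] A') (g : B →⋆ₐ[ℂ] B')

theorem map_inl (a : A) : map f g (inl a) = inl (f a) :=
  (map_tmul f g a 1).trans (by rw [map_one]; rfl)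

theorem map_inr (b : B) : map f g (inr b) = inr (g b) :=
  (map_tmul f g 1 b).trans (by rw [map_one]; rfl)

end MinTensor

namespace HeegaardSphere

open Toeplitz MinTensor

/-- The isometry `s₀`, with components `u ⊗ 1 ⊗ 1`, `s ⊗ 1 ⊗ 1` and `s ⊗ 1 ⊗ 1`. -/
noncomputable def s₀ : algebra := ⟨(inl circleU, inl s, inl s), by
  refine mem_algebra.2 ⟨?_, ?_, ?_⟩ <;>
    simp [p₀₁, p₁₀, p₀₂, p₂₀, p₁₂, p₂₁, map_inl, symbol_s]⟩

/-- The isometry `s₁`, with components `1 ⊗ s ⊗ 1`, `1 ⊗ u ⊗ 1` and `1 ⊗ s ⊗ 1`. -/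
noncomputable def s₁ : algebra := ⟨(inr (inl s), inr (inl circleU), inr (inl s)), by
  refine mem_algebra.2 ⟨?_, ?_, ?_⟩ <;>
    simp [p₀₁, p₁₀, p₀₂, p₂₀, p₁₂, p₂₁, map_inl, map_inr, symbol_s]⟩

/-- The isometry `s₂`, with components `1 ⊗ 1 ⊗ s`, `1 ⊗ 1 ⊗ s` and `1 ⊗ 1 ⊗ u`. -/
noncomputable def s₂ : algebra := ⟨(inr (inr s), inr (inr s), inr (inr circleU)), by
  refine mem_algebra.2 ⟨?_, ?_, ?_⟩ <;>
    simp [p₀₁, p₁₀, p₀₂, p₂₀, p₁₂, p₂₁, map_inr, symbol_s]⟩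

theorem star_s₀_mul : star s₀ * s₀ = 1 := by
  refine Subtype.ext (Prod.ext ?_ (Prod.ext ?_ ?_))
  · change star (inl circleU) * inl circleU = (1 : B₀)
    rw [← map_star, ← map_mul, star_circleU_mul, map_one]
  · change star (inl s) * inl s = (1 : B₁)
    rw [← map_star, ← map_mul, star_s_mul_s, map_one]
  · change star (inl s) * inl s = (1 : B₂)
    rw [← map_star, ← map_mul, star_s_mul_s, map_one]

theorem one_sub_s₀_fst : (1 - s₀ * star s₀ : algebra).1.1 = 0 := by
  change (1 : B₀) - inl circleU * star (inl circleU) = 0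
  rw [← map_star, ← map_mul, circleU_mul_star, map_one, sub_self]

theorem one_sub_s₁_snd : (1 - s₁ * star s₁ : algebra).1.2.1 = 0 := by
  change (1 : B₁) - inr (inl circleU) * star (inr (inl circleU)) = 0
  rw [← map_star, ← map_mul, ← map_star, ← map_mul, circleU_mul_star, map_one, map_one, sub_self]

theorem one_sub_s₂_thd : (1 - s₂ * star s₂ : algebra).1.2.2 = 0 := by
  change (1 : B₂) - inr (inr circleU) * star (inr (inr circleU)) = 0
  rw [← map_star, ← map_mul, ← map_star, ← map_mul, circleU_mul_star, map_one, map_one, sub_self]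

/-- In each component one of the three factors vanishes. -/
theorem mul_one_sub_range_eq_zero :
    (1 - s₀ * star s₀) * (1 - s₁ * star s₁) * (1 - s₂ * star s₂) = 0 := by
  refine Subtype.ext (Prod.ext ?_ (Prod.ext ?_ ?_))
  · change (1 - s₀ * star s₀ : algebra).1.1 * (1 - s₁ * star s₁ : algebra).1.1 *
      (1 - s₂ * star s₂ : algebra).1.1 = 0
    rw [one_sub_s₀_fst, zero_mul, zero_mul]
  · change (1 - s₀ * star s₀ : algebra).1.2.1 * (1 - s₁ * star s₁ : algebra).1.2.1 *
      (1 - s₂ * star s₂ : algebra).1.2.1 = 0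
    rw [one_sub_s₁_snd, mul_zero, zero_mul]
  · change (1 - s₀ * star s₀ : algebra).1.2.2 * (1 - s₁ * star s₁ : algebra).1.2.2 *
      (1 - s₂ * star s₂ : algebra).1.2.2 = 0
    rw [one_sub_s₂_thd, mul_zero]

theorem diagonalAction_s₀ (g : Circle) : diagonalAction g s₀ = circleU g • s₀ := by
  refine Subtype.ext (Prod.ext ?_ (Prod.ext ?_ ?_))
  · change MinTensor.map _ _ (inl circleU) = (g : ℂ) • inl circleU
    rw [map_inl, circleAction_circleU, map_smul]
  · change MinTensor.map _ _ (inl s) = (g : ℂ) • inl s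
    rw [map_inl, gaugeAction_s, map_smul]
  · change MinTensor.map _ _ (inl s) = (g : ℂ) • inl s
    rw [map_inl, gaugeAction_s, map_smul]

theorem diagonalAction_s₁ (g : Circle) : diagonalAction g s₁ = circleU g • s₁ := by
  refine Subtype.ext (Prod.ext ?_ (Prod.ext ?_ ?_))
  · change MinTensor.map _ (MinTensor.map _ _) (inr (inl s)) = (g : ℂ) • inr (inl s)
    rw [map_inr, map_inl, gaugeAction_s, map_smul, map_smul]
  · change MinTensor.map _ (MinTensor.map _ _) (inr (inl circleU)) = (g : ℂ) • inr (inl circleU)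
    rw [map_inr, map_inl, circleAction_circleU, map_smul, map_smul]
  · change MinTensor.map _ (MinTensor.map _ _) (inr (inl s)) = (g : ℂ) • inr (inl s)
    rw [map_inr, map_inl, gaugeAction_s, map_smul, map_smul]

theorem diagonalAction_s₂ (g : Circle) : diagonalAction g s₂ = circleU g • s₂ := by
  refine Subtype.ext (Prod.ext ?_ (Prod.ext ?_ ?_))
  · change MinTensor.map _ (MinTensor.map _ _) (inr (inr s)) = (g : ℂ) • inr (inr s)
    rw [map_inr, map_inr, gaugeAction_s, map_smul, map_smul]
  · change MinTensor.map _ (MinTensor.map _ _) (inr (inr s)) = (g : ℂ) • inr (inr s)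
    rw [map_inr, map_inr, gaugeAction_s, map_smul, map_smul]
  · change MinTensor.map _ (MinTensor.map _ _) (inr (inr circleU)) = (g : ℂ) • inr (inr circleU)
    rw [map_inr, map_inr, circleAction_circleU, map_smul, map_smul]

theorem diagonalAction_star {y : algebra} (hy : ∀ g, diagonalAction g y = circleU g • y)
    (g : Circle) : diagonalAction g (star y) = star circleU g • star y := by
  rw [map_star, hy, star_smul]
  rfl

end HeegaardSphere

/-- The diagonal `U(1)`-action on the C*-algebra of the Heegaard quantum 5-sphere is free: the
closed linear span of `{(x ⊗ 1) δ(y) | x, y ∈ C(S⁵_H)}` is `C(S⁵_H) ⊗ C(U(1))`. -/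
theorem theorem2p2 : HeegaardSphere.diagonalAction.IsFree := by
  open HeegaardSphere in
  refine diagonalAction.isFree_of_one_mem_homogeneousProducts (χ := circleU)
    (fun _ _ h => Circle.ext h) ?_ ?_
  · rw [← star_s₀_mul]
    exact diagonalAction.mul_mem_homogeneousProducts diagonalAction_s₀ _
  · have hmem {y : algebra} (hy : ∀ g, diagonalAction g y = circleU g • y) (x : algebra) :=
      diagonalAction.mul_mem_homogeneousProducts (diagonalAction_star hy) x
    rw [one_eq_combination_of_mul_eq_zero mul_one_sub_range_eq_zero]
    exact add_mem (add_mem (hmem diagonalAction_s₀ _) (hmem diagonalAction_s₁ _))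
      (hmem diagonalAction_s₂ _)
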